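/- Let $n\ge 1$. Let $\mathrm{SU}(n)$ act on $\mathbb{C}^n$ by its fundamental representation, and let the one-quark space be the two-index symmetric representation $\mathrm{Sym}^2(\mathbb{C}^n)\subset\mathbb{C}^n\otimes\mathbb{C}^n$, i.e. the tensors $Q^{\alpha\beta}=Q^{\beta\alpha}$ with $U\in\mathrm{SU}(n)$ acting by $U\otimes U$; its dimension is $n(n+1)/2$. For $k\ge 1$, a gauge wave function of $k$ quarks is an element of the $k$-fold tensor power $\bigl(\mathrm{Sym}^2(\mathbb{C}^n)\bigr)^{\otimes k}$, on which $\mathrm{SU}(n)$ acts diagonally; it is a gauge singlet if it is fixed by all of $\mathrm{SU}(n)$, and completely antisymmetric if it changes sign under the exchange of any two distinct quarks (tensor factors). Then: (1) for $k\ge1$, a nonzero gauge wave function of $k$ quarks that is a gauge singlet and completely antisymmetric exists if and only if $k=n(n+1)/2$; (2) for $k=n(n+1)/2$ it is unique up to a scalar factor: the space of completely antisymmetric gauge singlets of $n(n+1)/2$ quarks is one-dimensional; (3) for $k=n(n+1)/2$ this space is the whole completely antisymmetric subspace of $\bigl(\mathrm{Sym}^2(\mathbb{C}^n)\bigr)^{\otimes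 k}$, that is, the copy of $\Lambda^{k}(\mathrm{Sym}^2(\mathbb{C}^n))$ inside it. -/

import Mathlib

open scoped TensorProduct

/-- The fundamental representation of `SU(n)` on `ℂⁿ`: `U` acts on a column vector by `v ↦ U v`. -/
noncomputable def fundamentalRep (n : ℕ) :
    Representation ℂ (Matrix.specialUnitaryGroup (Fin n) ℂ) (Fin n → ℂ) where
  toFun U := Matrix.mulVecLin U.1
  map_one' := by
    rw [OneMemClass.coe_one]
    exact Matrix.mulVecLin_one
  map_mul' U V := by
    rw [Submonoid.coe_mul]
    exact Matrix.mulVecLin_mul U.1 V.1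

/-- The two-index symmetric tensors: the elements `Q` of `ℂⁿ ⊗ ℂⁿ` that do not change when the two
tensor factors are exchanged, `Q^{αβ} = Q^{βα}`. -/
def symTwo (n : ℕ) : Submodule ℂ ((Fin n → ℂ) ⊗[ℂ] (Fin n → ℂ)) where
  carrier := {t | TensorProduct.comm ℂ (Fin n → ℂ) (Fin n → ℂ) t = t}
  zero_mem' := map_zero _
  add_mem' {a b} ha hb := by
    simp only [Set.mem_ofPred_eq] at ha hb ⊢
    rw [map_add, ha, hb]
  smul_mem' c a ha := by
    simp only [Set.mem_ofPred_eq] at ha ⊢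
    rw [map_smul, ha]

/-- The two-index symmetric tensors are stable under `U ⊗ U`. -/
theorem symTwo_le_comap (n : ℕ) (U : Matrix.specialUnitaryGroup (Fin n) ℂ) :
    symTwo n ≤ (symTwo n).comap (((fundamentalRep n).tprod (fundamentalRep n)) U) := by
  intro t ht
  have h : ∀ s : (Fin n → ℂ) ⊗[ℂ] (Fin n → ℂ),
      TensorProduct.comm ℂ (Fin n → ℂ) (Fin n → ℂ)
          (((fundamentalRep n).tprod (fundamentalRep n)) U s) =
        ((fundamentalRep n).tprod (fundamentalRep n)) U
          (TensorProduct.comm ℂ (Fin n → ℂ) (Fin n → ℂ) s) := by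
    intro s
    induction s with
    | zero => simp only [map_zero]
    | tmul x y => simp only [Representation.tprod_apply, TensorProduct.map_tmul,
        TensorProduct.comm_tmul]
    | add x y hx hy => simp only [map_add, hx, hy]
  have ht' : TensorProduct.comm ℂ (Fin n → ℂ) (Fin n → ℂ) t = t := ht
  change TensorProduct.comm ℂ (Fin n → ℂ) (Fin n → ℂ)
    (((fundamentalRep n).tprod (fundamentalRep n)) U t) = _
  rw [h t, ht']

/-- The two-index symmetric representation of `SU(n)`, the restriction of `U ⊗ U` to the symmetric
tensors: the space of states of one quark. -/
noncomputable def quarkRep (n : ℕ) :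
    Representation ℂ (Matrix.specialUnitaryGroup (Fin n) ℂ) (symTwo n) :=
  ((fundamentalRep n).tprod (fundamentalRep n)).subrepresentation (symTwo n) (symTwo_le_comap n)

/-- The gauge wave functions of `k` quarks: the `k`-fold tensor power of the one-quark space. -/
abbrev WaveFunction (n k : ℕ) : Type := ⨂[ℂ] _ : Fin k, symTwo n

/-- The additive group of wave functions, with the addition of the tensor power. -/
noncomputable instance WaveFunction.addCommGroup (n k : ℕ) : AddCommGroup (WaveFunction n k) :=
  PiTensorProduct.instAddCommGroup (R := ℂ) (s := fun _ : Fin k => symTwo n)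


/-- The action of `SU(n)` on the wave functions of `k` quarks: `U` acts on all tensor factors
simultaneously. -/
noncomputable def waveFunctionRep (n k : ℕ) :
    Representation ℂ (Matrix.specialUnitaryGroup (Fin n) ℂ) (WaveFunction n k) where
  toFun U := PiTensorProduct.map fun _ => quarkRep n U
  map_one' := by
    simp only [map_one]
    exact PiTensorProduct.map_one
  map_mul' U V := by
    simp only [map_mul]
    exact PiTensorProduct.map_mul _ _

/-- The gauge singlets among the wave functions of `k` quarks. -/
noncomputable def gaugeSinglets (n k : ℕ) : Submodule ℂ (WaveFunction n k) :=
  (waveFunctionRep n k).invariants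

/-- The completely antisymmetric wave functions of `k` quarks: those that change sign under the
exchange of any two distinct quarks `i` and `j`. -/
noncomputable def antisymmetricWaveFunctions (n k : ℕ) : Submodule ℂ (WaveFunction n k) where
  carrier := {ψ | ∀ i j : Fin k, i ≠ j →
    PiTensorProduct.reindex ℂ (fun _ : Fin k => symTwo n) (Equiv.swap i j) ψ = -ψ}
  zero_mem' i j _ := by
    rw [map_zero]
    exact neg_zero.symm
  add_mem' {a b} ha hb i j hij := by
    rw [map_add, ha i j hij, hb i j hij]
    exact (neg_add a b).symm
  smul_mem' c a ha i j hij := by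
    rw [map_smul, ha i j hij]
    exact smul_neg c a

/-!
Put `N = n(n+1)/2 = dim Sym²(ℂⁿ)`.

*For `N` quarks.* The antisymmetric tensors of degree `N` over a space of dimension `N` form a line,
on which `U` acts by `det (Sym² U)`. This determinant is `(det U) ^ (n + 1)` for every matrix
(`det_symSquareMatrix`): both sides are multiplicative, so diagonal matrices and transvections
suffice. It is `1` on `SU(n)`, so that all antisymmetric tensors are singlets
(`antisymmetric_le_gaugeSinglets`, `finrank_antisymmetric`).

*No other number of quarks.* The Casimir operator `∑ E_{ij} E_{ji}` of `gl(n)` is evaluated in two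
ways on an antisymmetric singlet `ψ ≠ 0` of `k` quarks, seen as a tensor over `ℂⁿ` with `2k` sites.
Since `ψ` is `SU(n)`-invariant, a matrix `Y` acts on it by `(tr Y / n) · 2k`, and so the Casimir
operator acts by `4k² / n`. On the other hand the Casimir operator is `2kn` plus twice the sum of
all transpositions of sites. Each transposition of the two indices of one quark gives `1`, and the
four transpositions between two different quarks cancel, because the exchange of these quarks
changes the sign of `ψ`. Thus `4k² / n = 2kn + 2k`, and `k = N` because `k ≥ 1`. The proof uses a
sharper form of this identity, which singles out one quark (`sum_swap_of_invariant`,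
`sum_siteCoeff_comp_swap`). Invariance under the group is turned into invariance under the Lie
algebra by differentiating one-parameter subgroups of `SU(n)` in components.
-/

/-! ### Components of symmetric tensors -/

/-- The basis `e_i ⊗ e_j` of `ℂⁿ ⊗ ℂⁿ`. -/
noncomputable def tensorBasis (n : ℕ) :
    Module.Basis (Fin n × Fin n) ℂ ((Fin n → ℂ) ⊗[ℂ] (Fin n → ℂ)) :=
  (Pi.basisFun ℂ (Fin n)).tensorProduct (Pi.basisFun ℂ (Fin n))

theorem tensorBasis_repr_tmul {n : ℕ} (v w : Fin n → ℂ) (p : Fin n × Fin n) :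
    (tensorBasis n).repr (v ⊗ₜ w) p = v p.1 * w p.2 := by
  obtain ⟨i, j⟩ := p
  rw [tensorBasis, Module.Basis.tensorProduct_repr_tmul_apply]
  simp [mul_comm]

theorem tensorBasis_repr_comm {n : ℕ} (t : (Fin n → ℂ) ⊗[ℂ] (Fin n → ℂ)) (p : Fin n × Fin n) :
    (tensorBasis n).repr (TensorProduct.comm ℂ (Fin n → ℂ) (Fin n → ℂ) t) p =
      (tensorBasis n).repr t p.swap := by
  induction t with
  | zero => simp
  | tmul v w => simp [tensorBasis_repr_tmul, mul_comm]
  | add x y hx hy => simp [hx, hy]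

theorem tensorBasis_repr_map {n : ℕ} (M : Matrix (Fin n) (Fin n) ℂ)
    (t : (Fin n → ℂ) ⊗[ℂ] (Fin n → ℂ)) (p : Fin n × Fin n) :
    (tensorBasis n).repr (TensorProduct.map M.mulVecLin M.mulVecLin t) p =
      ∑ q : Fin n × Fin n, M p.1 q.1 * M p.2 q.2 * (tensorBasis n).repr t q := by
  induction t with
  | zero => simp
  | tmul v w =>
    simp only [TensorProduct.map_tmul, tensorBasis_repr_tmul, Matrix.mulVecLin_apply,
      Matrix.mulVec, dotProduct, Finset.sum_mul_sum, Fintype.sum_prod_type]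
    exact Finset.sum_congr rfl fun _ _ => Finset.sum_congr rfl fun _ _ => by ring
  | add x y hx hy => simp [hx, hy, mul_add, Finset.sum_add_distrib]

/-- A symmetric tensor `Q` is the same as the function `s(i, j) ↦ Q^{ij}` on unordered pairs. -/
noncomputable def symTwoEquiv (n : ℕ) : symTwo n ≃ₗ[ℂ] (Sym2 (Fin n) → ℂ) where
  toFun q := Sym2.lift ⟨fun i j => (tensorBasis n).repr q.1 (i, j), fun i j => by
    have h : TensorProduct.comm ℂ (Fin n → ℂ) (Fin n → ℂ) q.1 = q.1 := q.2
    conv_lhs => rw [← h]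
    exact tensorBasis_repr_comm q.1 (i, j)⟩
  map_add' q r := by
    ext z
    induction z with | h i j => simp
  map_smul' c q := by
    ext z
    induction z with | h i j => simp
  invFun f := ⟨(tensorBasis n).equivFun.symm fun p => f s(p.1, p.2), by
    change TensorProduct.comm ℂ (Fin n → ℂ) (Fin n → ℂ) _ = _
    refine (tensorBasis n).ext_elem fun p => ?_
    rw [tensorBasis_repr_comm, ← Module.Basis.equivFun_apply, LinearEquiv.apply_symm_apply]
    simp [Sym2.eq_swap]⟩
  left_inv q := by
    apply Subtype.ext
    refine (tensorBasis n).ext_elem fun p => ?_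
    rw [← Module.Basis.equivFun_apply, LinearEquiv.apply_symm_apply]
    simp
  right_inv f := by
    ext z
    induction z with
    | h i j =>
      simp only [Sym2.lift_mk]
      rw [← Module.Basis.equivFun_apply, LinearEquiv.apply_symm_apply]

theorem symTwoEquiv_mk {n : ℕ} (q : symTwo n) (i j : Fin n) :
    symTwoEquiv n q s(i, j) = (tensorBasis n).repr q.1 (i, j) := rfl

/-- The basis of the symmetric tensors whose coordinates are the components `Q^{ij}`, indexed by
unordered pairs. -/
noncomputable def symTwoBasis (n : ℕ) : Module.Basis (Sym2 (Fin n)) ℂ (symTwo n) :=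
  Module.Basis.ofEquivFun (symTwoEquiv n)

theorem symTwoBasis_repr_mk {n : ℕ} (q : symTwo n) (i j : Fin n) :
    (symTwoBasis n).repr q s(i, j) = (tensorBasis n).repr q.1 (i, j) := by
  simp [symTwoBasis, symTwoEquiv_mk]

theorem card_sym2_fin (n : ℕ) : Fintype.card (Sym2 (Fin n)) = n * (n + 1) / 2 := by
  rw [Sym2.card, Fintype.card_fin, Nat.choose_two_right, mul_comm, Nat.add_sub_cancel]

theorem finrank_symTwo (n : ℕ) : Module.finrank ℂ (symTwo n) = n * (n + 1) / 2 := by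
  rw [Module.finrank_eq_card_basis (symTwoBasis n), card_sym2_fin]

theorem map_mulVecLin_mem_symTwo {n : ℕ} (M : Matrix (Fin n) (Fin n) ℂ)
    {t : (Fin n → ℂ) ⊗[ℂ] (Fin n → ℂ)} (ht : t ∈ symTwo n) :
    TensorProduct.map M.mulVecLin M.mulVecLin t ∈ symTwo n := by
  have ht' : TensorProduct.comm ℂ (Fin n → ℂ) (Fin n → ℂ) t = t := ht
  change TensorProduct.comm ℂ (Fin n → ℂ) (Fin n → ℂ) _ = _
  conv_rhs => rw [← ht']
  rw [TensorProduct.map_comm]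

/-- The action of an arbitrary matrix `M` on the symmetric tensors by `M ⊗ M`. Dropping unitarity
makes the transvections available for computing its determinant. -/
noncomputable def symSquare {n : ℕ} (M : Matrix (Fin n) (Fin n) ℂ) : symTwo n →ₗ[ℂ] symTwo n :=
  (TensorProduct.map M.mulVecLin M.mulVecLin).restrict fun _ => map_mulVecLin_mem_symTwo M

theorem symTwoBasis_repr_symSquare {n : ℕ} (M : Matrix (Fin n) (Fin n) ℂ) (q : symTwo n)
    (i j : Fin n) :
    (symTwoBasis n).repr (symSquare M q) s(i, j) =
      ∑ p : Fin n × Fin n, M i p.1 * M j p.2 * (symTwoBasis n).repr q s(p.1, p.2) := by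
  simp only [symTwoBasis_repr_mk]
  exact tensorBasis_repr_map M q.1 (i, j)

theorem symSquare_one {n : ℕ} : symSquare (1 : Matrix (Fin n) (Fin n) ℂ) = 1 := by
  ext q
  simp [symSquare]

theorem symSquare_mul {n : ℕ} (M N : Matrix (Fin n) (Fin n) ℂ) :
    symSquare (M * N) = symSquare M * symSquare N := by
  ext q : 2
  simp [symSquare, Matrix.mulVecLin_mul, TensorProduct.map_comp]

/-! ### The determinant of the symmetric square -/

/-- The matrix of `symSquare M` in the basis `symTwoBasis`. -/
noncomputable def symSquareMatrix {n : ℕ} (M : Matrix (Fin n) (Fin n) ℂ) :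
    Matrix (Sym2 (Fin n)) (Sym2 (Fin n)) ℂ :=
  LinearMap.toMatrix (symTwoBasis n) (symTwoBasis n) (symSquare M)

theorem symSquareMatrix_one {n : ℕ} : symSquareMatrix (1 : Matrix (Fin n) (Fin n) ℂ) = 1 := by
  rw [symSquareMatrix, symSquare_one, LinearMap.toMatrix_one]

theorem symSquareMatrix_mul {n : ℕ} (M N : Matrix (Fin n) (Fin n) ℂ) :
    symSquareMatrix (M * N) = symSquareMatrix M * symSquareMatrix N := by
  rw [symSquareMatrix, symSquare_mul, LinearMap.toMatrix_mul]
  rfl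

open Matrix in
theorem det_symSquareMatrix_diagonal {n : ℕ} (d : Fin n → ℂ) :
    (symSquareMatrix (Matrix.diagonal d)).det = (Matrix.diagonal d).det ^ (n + 1) := by
  have hM : symSquareMatrix (Matrix.diagonal d) =
      Matrix.diagonal fun z => d z.inf * d z.sup := by
    ext z w
    have hz : z = s(z.inf, z.sup) := (Sym2.sortEquiv.left_inv z).symm
    rw [symSquareMatrix, LinearMap.toMatrix_apply, hz, symTwoBasis_repr_symSquare,
      Finset.sum_eq_single (z.inf, z.sup)]
    · simp only [diagonal_apply_eq, ← hz, Module.Basis.repr_self]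
      rcases eq_or_ne z w with rfl | h
      · simp
      · simp [h, Finsupp.single_eq_of_ne]
    · rintro ⟨a, b⟩ - h
      by_cases ha : z.inf = a
      · have hb : z.sup ≠ b := fun hb => h (by rw [ha, hb])
        simp [diagonal_apply_ne _ hb]
      · simp [diagonal_apply_ne _ ha]
    · simp
  rw [hM, det_diagonal, det_diagonal]
  -- Each `d i` occurs once for every pair `i ≤ j` and once for every pair `j ≤ i`: `n + 1` times.
  have h1 : ∏ z : Sym2 (Fin n), d z.inf * d z.sup =
      ∏ p : {p : Fin n × Fin n // p.1 ≤ p.2}, d p.1.1 * d p.1.2 :=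
    Fintype.prod_equiv Sym2.sortEquiv _ _ fun z => rfl
  have h2 : ∀ f : Fin n × Fin n → ℂ, ∏ p : {p : Fin n × Fin n // p.1 ≤ p.2}, f p.1 =
      ∏ i, ∏ j, if i ≤ j then f (i, j) else 1 := fun f => by
    rw [← Fintype.prod_prod_type' (f := fun i j => if i ≤ j then f (i, j) else 1),
      ← Finset.prod_filter]
    exact (Finset.prod_subtype _ (by simp) f).symm
  rw [h1, Finset.prod_mul_distrib, h2 fun p => d p.1, h2 fun p => d p.2,
    Finset.prod_comm (f := fun i j => if i ≤ j then d j else 1), ← Finset.prod_mul_distrib,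
    ← Finset.prod_pow]
  refine Finset.prod_congr rfl fun i _ => ?_
  rw [← Finset.prod_filter, ← Finset.prod_filter]
  dsimp only
  rw [Finset.prod_const, Finset.prod_const, ← pow_add]
  congr 1
  have e1 : (Finset.univ.filter fun j => i ≤ j) = Finset.Ici i := by ext; simp
  have e2 : (Finset.univ.filter fun j => j ≤ i) = Finset.Iic i := by ext; simp
  rw [e1, e2, Fin.card_Ici, Fin.card_Iic]
  omega

open Matrix in
/-- Conjugation by a diagonal matrix turns the transvection with coefficient `c` into the one with
coefficient `2c`, which is its square. Hence every multiplicative function that does not vanish on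
invertible diagonal matrices takes the value `1` on transvections. -/
theorem det_symSquareMatrix_transvection {n : ℕ} (t : TransvectionStruct (Fin n) ℂ) :
    (symSquareMatrix t.toMatrix).det = 1 := by
  obtain ⟨i, j, hij, c⟩ := t
  change (symSquareMatrix (transvection i j c)).det = 1
  let χ : Matrix (Fin n) (Fin n) ℂ → ℂ := fun M => (symSquareMatrix M).det
  have hχ : ∀ M N, χ (M * N) = χ M * χ N := fun M N => by simp [χ, symSquareMatrix_mul]
  have hone : χ 1 = 1 := by simp [χ, symSquareMatrix_one]
  have h0 : χ (transvection i j c) ≠ 0 := fun h => by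
    have := hχ (transvection i j c) (transvection i j (-c))
    rw [transvection_mul_transvection_same _ _ hij, add_neg_cancel, transvection_zero, hone, h,
      zero_mul] at this
    exact one_ne_zero this
  have hsq : χ (transvection i j (c + c)) = χ (transvection i j c) * χ (transvection i j c) := by
    rw [← hχ, transvection_mul_transvection_same _ _ hij]
  let d : Fin n → ℂ := Function.update 1 i 2
  have hconj : diagonal d * transvection i j c = transvection i j (c + c) * diagonal d := by
    ext a b
    simp only [diagonal_mul, mul_diagonal, transvection, Matrix.add_apply, one_apply, single_apply,
      d, Function.update_apply, Pi.one_apply]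
    grind
  have hd : χ (diagonal d) ≠ 0 := by
    change (symSquareMatrix (diagonal d)).det ≠ 0
    rw [det_symSquareMatrix_diagonal, det_diagonal]
    refine pow_ne_zero _ (Finset.prod_ne_zero_iff.2 fun a _ => ?_)
    by_cases ha : a = i <;> simp [d, ha]
  have key := congrArg χ hconj
  rw [hχ, hχ, hsq, mul_comm] at key
  have := mul_right_cancel₀ hd key
  exact (mul_left_cancel₀ h0 (by rw [mul_one]; exact this)).symm

theorem det_symSquareMatrix {n : ℕ} (M : Matrix (Fin n) (Fin n) ℂ) :
    (symSquareMatrix M).det = M.det ^ (n + 1) := by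
  refine Matrix.diagonal_transvection_induction
    (fun M => (symSquareMatrix M).det = M.det ^ (n + 1)) M
    (fun d _ => det_symSquareMatrix_diagonal d) (fun t => ?_) fun A B hA hB => ?_
  · rw [det_symSquareMatrix_transvection, Matrix.TransvectionStruct.det, one_pow]
  · rw [symSquareMatrix_mul, Matrix.det_mul, hA, hB, Matrix.det_mul, mul_pow]

/-! ### Tensors over `ℂⁿ` invariant under `SU(n)` -/

/-- The derived action of a matrix `Y` on tensors over `ℂⁿ` with sites `ι`: the sum over the sites
`a` of `Y` acting on the index at `a`. A tensor is given by its components `T x`. -/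
noncomputable def derivationAction {ι : Type*} [Fintype ι] [DecidableEq ι] {n : ℕ}
    (Y : Matrix (Fin n) (Fin n) ℂ) (T : (ι → Fin n) → ℂ) (x : ι → Fin n) : ℂ :=
  ∑ a, ∑ j, Y (x a) j * T (Function.update x a j)

section
variable {ι : Type*} [Fintype ι] [DecidableEq ι] {n : ℕ}

theorem sum_prod_erase_one_mul (x : ι → Fin n) (a : ι) (F : (ι → Fin n) → ℂ) :
    ∑ y, (∏ b ∈ Finset.univ.erase a, (1 : Matrix (Fin n) (Fin n) ℂ) (x b) (y b)) * F y =
      ∑ j, F (Function.update x a j) := by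
  symm
  refine Fintype.sum_of_injective (fun j => Function.update x a j)
    (Function.update_injective x a) _ _ (fun y hy => ?_) fun j => ?_
  · suffices h : ∃ b ∈ Finset.univ.erase a, x b ≠ y b by
      obtain ⟨b, hb, h⟩ := h
      have h' : (1 : Matrix (Fin n) (Fin n) ℂ) (x b) (y b) = 0 := Matrix.one_apply_ne h
      exact mul_eq_zero_of_left (Finset.prod_eq_zero hb h') _
    by_contra! h
    refine hy ⟨y a, funext fun b => ?_⟩
    rcases eq_or_ne b a with rfl | hb
    · simp
    · change Function.update x a (y a) b = y b
      rw [Function.update_of_ne hb, h b (by simp [hb])]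
  · rw [Finset.prod_eq_one, one_mul]
    intro b hb
    rw [Function.update_of_ne (Finset.ne_of_mem_erase hb), Matrix.one_apply_eq]

/-- A tensor fixed by a curve of matrices through `1` is killed by the derived action of the
velocity at `1`. -/
theorem derivationAction_eq_zero_of_curve {T : (ι → Fin n) → ℂ}
    {U : ℝ → Matrix (Fin n) (Fin n) ℂ} {Y : Matrix (Fin n) (Fin n) ℂ} (h0 : U 0 = 1)
    (hU : ∀ i j, HasDerivAt (fun t => U t i j) (Y i j) 0)
    (hT : ∀ t x, ∑ y, (∏ a, U t (x a) (y a)) * T y = T x) (x : ι → Fin n) :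
    derivationAction Y T x = 0 := by
  have h1 : HasDerivAt (fun t => ∑ y, (∏ a, U t (x a) (y a)) * T y)
      (∑ y, (∑ a, (∏ b ∈ Finset.univ.erase a, U 0 (x b) (y b)) • Y (x a) (y a)) * T y) 0 :=
    HasDerivAt.fun_sum fun y _ =>
      (HasDerivAt.fun_finsetProd fun a _ => hU (x a) (y a)).mul_const (T y)
  simp only [hT, h0] at h1
  rw [← h1.unique (hasDerivAt_const (0 : ℝ) (T x)), derivationAction]
  simp only [Finset.sum_mul, smul_eq_mul]
  rw [Finset.sum_comm (s := (Finset.univ : Finset (ι → Fin n)))]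
  refine Finset.sum_congr rfl fun a _ => ?_
  simp only [mul_assoc]
  rw [sum_prod_erase_one_mul x a fun y => Y (x a) (y a) * T y]
  simp

theorem derivationAction_add (Y Z : Matrix (Fin n) (Fin n) ℂ) (T : (ι → Fin n) → ℂ)
    (x : ι → Fin n) :
    derivationAction (Y + Z) T x = derivationAction Y T x + derivationAction Z T x := by
  simp [derivationAction, add_mul, Finset.sum_add_distrib]

theorem derivationAction_smul (c : ℂ) (Y : Matrix (Fin n) (Fin n) ℂ) (T : (ι → Fin n) → ℂ)
    (x : ι → Fin n) :
    derivationAction (c • Y) T x = c * derivationAction Y T x := by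
  simp [derivationAction, mul_assoc, Finset.mul_sum]

theorem derivationAction_one (T : (ι → Fin n) → ℂ) (x : ι → Fin n) :
    derivationAction 1 T x = Fintype.card ι * T x := by
  have h : ∀ a, ∑ j, (1 : Matrix (Fin n) (Fin n) ℂ) (x a) j * T (Function.update x a j) = T x := by
    intro a
    rw [Finset.sum_eq_single (x a)]
    · simp
    · intro j _ hj
      rw [Matrix.one_apply_ne hj.symm, zero_mul]
    · simp
  simp [derivationAction, h]

theorem derivationAction_single (i j : Fin n) (T : (ι → Fin n) → ℂ) (x : ι → Fin n) :
    derivationAction (Matrix.single i j 1) T x =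
      ∑ a, if x a = i then T (Function.update x a j) else 0 := by
  refine Finset.sum_congr rfl fun a _ => ?_
  rw [Finset.sum_eq_single j]
  · by_cases h : x a = i
    · simp [h]
    · simp [h, Ne.symm h]
  · intro k _ hk
    simp [hk.symm]
  · simp

open Matrix in
/-- The curve used is `t ↦ exp(itH) = V diag(exp(itλ)) V⋆`, with `V` diagonalizing `H`; it lies in
`SU(n)` because the eigenvalues `λ` sum to zero. -/
theorem derivationAction_eq_zero_of_isHermitian {T : (ι → Fin n) → ℂ}
    (hT : ∀ U : Matrix.specialUnitaryGroup (Fin n) ℂ, ∀ x,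
      ∑ y, (∏ a, U.1 (x a) (y a)) * T y = T x)
    {H : Matrix (Fin n) (Fin n) ℂ} (hH : H.IsHermitian) (htr : H.trace = 0) (x : ι → Fin n) :
    derivationAction H T x = 0 := by
  let V := hH.eigenvectorUnitary
  let e : ℝ → Fin n → ℂ := fun t j => Complex.exp (t * (Complex.I * hH.eigenvalues j))
  let U : ℝ → Matrix (Fin n) (Fin n) ℂ := fun t =>
    (V : Matrix (Fin n) (Fin n) ℂ) * diagonal (e t) * (star V : Matrix (Fin n) (Fin n) ℂ)
  have hVV : (V : Matrix (Fin n) (Fin n) ℂ) * (star V : Matrix (Fin n) (Fin n) ℂ) = 1 :=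
    Unitary.mul_star_self_of_mem V.2
  have hVV' : (star V : Matrix (Fin n) (Fin n) ℂ) * (V : Matrix (Fin n) (Fin n) ℂ) = 1 :=
    Unitary.star_mul_self_of_mem V.2
  have he : ∀ t, diagonal (e t) * star (diagonal (e t)) = 1 := fun t => by
    rw [star_eq_conjTranspose, diagonal_conjTranspose, diagonal_mul_diagonal, ← diagonal_one]
    congr 1
    funext j
    simp only [e, Pi.star_apply, RCLike.star_def, ← Complex.exp_conj, ← Complex.exp_add]
    simp
  have hmem : ∀ t, U t ∈ specialUnitaryGroup (Fin n) ℂ := fun t => by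
    rw [mem_specialUnitaryGroup_iff, mem_unitaryGroup_iff]
    constructor
    · simp only [U, star_mul, star_star]
      calc _ = (V : Matrix (Fin n) (Fin n) ℂ) *
            (diagonal (e t) * ((star V : Matrix (Fin n) (Fin n) ℂ) * V) * star (diagonal (e t))) *
            (star V : Matrix (Fin n) (Fin n) ℂ) := by simp only [Matrix.mul_assoc]
        _ = 1 := by rw [hVV', Matrix.mul_one, he, Matrix.mul_one, hVV]
    · simp only [U]
      rw [det_mul_right_comm, hVV, Matrix.one_mul, det_diagonal]
      simp only [e, ← Complex.exp_sum, ← Finset.mul_sum]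
      have hsum : ∑ i, (hH.eigenvalues i : ℂ) = 0 :=
        hH.trace_eq_sum_eigenvalues.symm.trans htr
      rw [hsum, mul_zero, mul_zero, Complex.exp_zero]
  have hderiv : ∀ i j, HasDerivAt (fun t => U t i j) ((Complex.I • H) i j) 0 := by
    intro i j
    have h1 : (fun t => U t i j) = fun t => ∑ l, V.1 i l * e t l * (star V.1) l j := by
      funext t
      refine (mul_apply (M := (V : Matrix (Fin n) (Fin n) ℂ) * diagonal (e t))).trans ?_
      exact Finset.sum_congr rfl fun l _ => by rw [mul_diagonal]
    have h2 : (Complex.I • H) i j =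
        ∑ l, V.1 i l * (Complex.I * hH.eigenvalues l) * (star V.1) l j := by
      conv_lhs => rw [hH.spectral_theorem]
      rw [Matrix.smul_apply, Unitary.conjStarAlgAut_apply, mul_apply, Finset.smul_sum]
      refine Finset.sum_congr rfl fun l _ => ?_
      rw [mul_diagonal]
      simp only [smul_eq_mul, Function.comp_apply, V]
      simp
      ring
    rw [h1, h2]
    refine HasDerivAt.fun_sum fun l _ => ((HasDerivAt.const_mul _ ?_).mul_const _)
    have h3 : HasDerivAt (fun t : ℝ => (t : ℂ) * (Complex.I * hH.eigenvalues l))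
        (1 * (Complex.I * hH.eigenvalues l)) 0 :=
      (Complex.ofRealCLM.hasDerivAt (x := (0 : ℝ))).mul_const _
    simpa [e] using h3.cexp
  have h0 : U 0 = 1 := by
    have : e 0 = 1 := by funext j; simp [e]
    simp only [U, this]
    rw [show diagonal (1 : Fin n → ℂ) = 1 from diagonal_one, Matrix.mul_one, hVV]
  have := derivationAction_eq_zero_of_curve h0 hderiv (fun t x => hT ⟨U t, hmem t⟩ x) x
  rw [derivationAction_smul] at this
  exact (mul_eq_zero.1 this).resolve_left Complex.I_ne_zero

open Matrix in
/-- The traceless matrices are the complex span of the traceless Hermitian ones. -/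
theorem derivationAction_eq_zero_of_trace_eq_zero {T : (ι → Fin n) → ℂ}
    (hT : ∀ U : Matrix.specialUnitaryGroup (Fin n) ℂ, ∀ x,
      ∑ y, (∏ a, U.1 (x a) (y a)) * T y = T x)
    {Y : Matrix (Fin n) (Fin n) ℂ} (htr : Y.trace = 0) (x : ι → Fin n) :
    derivationAction Y T x = 0 := by
  have h1 : (Y + Yᴴ).IsHermitian := isHermitian_add_transpose_self Y
  have h2 : (Complex.I • (Y - Yᴴ)).IsHermitian := by
    rw [IsHermitian, conjTranspose_smul, conjTranspose_sub, conjTranspose_conjTranspose]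
    simp [← smul_neg]
  have hY : Y = (1 / 2 : ℂ) • (Y + Yᴴ) + (-Complex.I / 2) • (Complex.I • (Y - Yᴴ)) := by
    rw [smul_smul, show -Complex.I / 2 * Complex.I = 1 / 2 by
      rw [neg_div, neg_mul, div_mul_eq_mul_div, Complex.I_mul_I]; norm_num, ← smul_add,
      add_add_sub_cancel, ← two_smul ℂ Y, smul_smul]
    norm_num
  rw [hY, derivationAction_add, derivationAction_smul, derivationAction_smul,
    derivationAction_eq_zero_of_isHermitian hT h1 (by simp [trace_add, htr]),
    derivationAction_eq_zero_of_isHermitian hT h2 (by simp [trace_sub, htr])]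
  simp

/-- On an `SU(n)`-invariant tensor, `Y` acts as its scalar part `(tr Y / n) · 1`. The equation is
multiplied by `n`, so that it needs no division. -/
theorem derivationAction_eq_trace_mul {T : (ι → Fin n) → ℂ}
    (hT : ∀ U : Matrix.specialUnitaryGroup (Fin n) ℂ, ∀ x,
      ∑ y, (∏ a, U.1 (x a) (y a)) * T y = T x)
    (Y : Matrix (Fin n) (Fin n) ℂ) (x : ι → Fin n) :
    n * derivationAction Y T x = Y.trace * Fintype.card ι * T x := by
  have htr : ((n : ℂ) • Y + (-Y.trace) • (1 : Matrix (Fin n) (Fin n) ℂ)).trace = 0 := by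
    simp [Matrix.trace_add, Matrix.trace_smul, mul_comm]
  have := derivationAction_eq_zero_of_trace_eq_zero hT htr x
  rw [derivationAction_add, derivationAction_smul, derivationAction_smul,
    derivationAction_one] at this
  linear_combination this

/-- For an `SU(n)`-invariant tensor, the transpositions of the site `b` with all the other sites sum
to the scalar `card ι / n - n`. This is the part at `b` of the evaluation of the Casimir
operator. -/
theorem sum_swap_of_invariant {T : (ι → Fin n) → ℂ}
    (hT : ∀ U : Matrix.specialUnitaryGroup (Fin n) ℂ, ∀ x,
      ∑ y, (∏ a, U.1 (x a) (y a)) * T y = T x)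
    (b : ι) (x : ι → Fin n) :
    n * (n * T x + ∑ a ∈ Finset.univ.erase b, T (x ∘ Equiv.swap a b)) =
      Fintype.card ι * T x := by
  -- The matrix unit `E_{ij}` with `j = x b` is applied at `x` with its index at `b` changed to `i`,
  -- and the result is summed over `i`. The site `b` gives `n * T x`; another site `a` contributes
  -- only for `i = x a`, where it puts `x b` at `a` and `x a` at `b`.
  have h1 : ∀ i, n * derivationAction (Matrix.single i (x b) 1) T (Function.update x b i) =
      if i = x b then Fintype.card ι * T x else 0 := by
    intro i
    rw [derivationAction_eq_trace_mul hT]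
    split_ifs with h
    · subst h
      simp
    · rw [Matrix.trace_single_eq_of_ne _ _ _ h]
      simp
  have h2 := Finset.sum_congr (rfl : (Finset.univ : Finset (Fin n)) = Finset.univ)
    fun i _ => h1 i
  rw [Finset.sum_ite_eq' Finset.univ (x b) fun _ => _, if_pos (Finset.mem_univ _),
    ← Finset.mul_sum] at h2
  rw [← h2]
  congr 1
  simp only [derivationAction_single]
  rw [Finset.sum_comm, ← Finset.add_sum_erase _ _ (Finset.mem_univ b)]
  congr 1
  · simp
  · refine Finset.sum_congr rfl fun a ha => ?_
    have hab : a ≠ b := Finset.ne_of_mem_erase ha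
    rw [Finset.sum_eq_single (x a)]
    · rw [Function.update_of_ne hab, if_pos rfl]
      congr 1
      funext c
      simp only [Function.comp_apply, Equiv.swap_apply_def, Function.update_apply]
      grind
    · intro i _ hi
      rw [Function.update_of_ne hab, if_neg hi.symm]
    · simp
end

/-! ### Components in a tensor power -/

theorem reindex_map_add_map_eq_zero {ι W : Type*} [AddCommMonoid W] [Module ℂ W]
    (g : W →ₗ[ℂ] W) (σ : Equiv.Perm ι) {ψ : ⨂[ℂ] _ : ι, W}
    (h : PiTensorProduct.reindex ℂ (fun _ : ι => W) σ ψ + ψ = 0) :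
    PiTensorProduct.reindex ℂ (fun _ : ι => W) σ (PiTensorProduct.map (fun _ => g) ψ) +
      PiTensorProduct.map (fun _ => g) ψ = 0 := by
  have h1 := PiTensorProduct.map_reindex (fun _ : ι => g) σ ψ
  rw [← h1, ← map_add, h, map_zero]

section
variable {ι κ W : Type*} [Fintype ι] [AddCommMonoid W] [Module ℂ W]

/-- The component of a tensor of `⨂ W` at the family `z` of basis indices, for a basis `b`
of `W`. -/
noncomputable def tensorCoeff (b : Module.Basis κ ℂ W) (ψ : ⨂[ℂ] _ : ι, W) (z : ι → κ) : ℂ :=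
  (Basis.piTensorProduct fun _ : ι => b).repr ψ z

theorem tensorCoeff_tprod (b : Module.Basis κ ℂ W) (f : ι → W) (z : ι → κ) :
    tensorCoeff b (PiTensorProduct.tprod ℂ f) z = ∏ p, b.repr (f p) (z p) :=
  Basis.piTensorProduct_repr_tprod_apply _ _ _

theorem tensorCoeff_add (b : Module.Basis κ ℂ W) (φ ψ : ⨂[ℂ] _ : ι, W) (z : ι → κ) :
    tensorCoeff b (φ + ψ) z = tensorCoeff b φ z + tensorCoeff b ψ z := by
  simp only [tensorCoeff, map_add, Finsupp.add_apply]

theorem tensorCoeff_smul (b : Module.Basis κ ℂ W) (c : ℂ) (ψ : ⨂[ℂ] _ : ι, W) (z : ι → κ) :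
    tensorCoeff b (c • ψ) z = c * tensorCoeff b ψ z := by
  simp only [tensorCoeff, map_smul, Finsupp.smul_apply, smul_eq_mul]

theorem tensorCoeff_zero (b : Module.Basis κ ℂ W) (z : ι → κ) :
    tensorCoeff b (0 : ⨂[ℂ] _ : ι, W) z = 0 := by
  simp only [tensorCoeff, map_zero, Finsupp.zero_apply]

theorem tensorCoeff_injective (b : Module.Basis κ ℂ W) :
    Function.Injective (tensorCoeff (ι := ι) b) := fun _ _ h =>
  (Basis.piTensorProduct fun _ : ι => b).ext_elem fun z => congrFun h z

theorem tensorCoeff_surjective [Finite κ] (b : Module.Basis κ ℂ W) :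
    Function.Surjective (tensorCoeff (ι := ι) b) := fun f =>
  have : Fintype (ι → κ) := Fintype.ofFinite _
  ⟨(Basis.piTensorProduct fun _ : ι => b).equivFun.symm f,
    (Basis.piTensorProduct fun _ : ι => b).equivFun.apply_symm_apply f⟩

theorem tensorCoeff_reindex (b : Module.Basis κ ℂ W) (σ : Equiv.Perm ι)
    (ψ : ⨂[ℂ] _ : ι, W) (z : ι → κ) :
    tensorCoeff b (PiTensorProduct.reindex ℂ (fun _ : ι => W) σ ψ) z =
      tensorCoeff b ψ (z ∘ σ) := by
  induction ψ using PiTensorProduct.induction_on with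
  | smul_tprod r f =>
    simp only [map_smul, PiTensorProduct.reindex_tprod, tensorCoeff_smul, tensorCoeff_tprod,
      Function.comp_apply]
    congr 1
    exact Fintype.prod_equiv σ.symm _ _ fun i => by simp
  | add x y hx hy => simp only [map_add, tensorCoeff_add, hx, hy]

/-- Antisymmetry is written as a vanishing sum, which needs no negation on the tensor power of the
additive monoid `W`. -/
theorem reindex_add_self_eq_zero_iff (b : Module.Basis κ ℂ W) (σ : Equiv.Perm ι)
    (ψ : ⨂[ℂ] _ : ι, W) :
    PiTensorProduct.reindex ℂ (fun _ : ι => W) σ ψ + ψ = 0 ↔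
      ∀ z, tensorCoeff b ψ (z ∘ σ) = -tensorCoeff b ψ z := by
  rw [← (tensorCoeff_injective b).eq_iff, funext_iff]
  simp only [tensorCoeff_add, tensorCoeff_reindex, tensorCoeff_zero, eq_neg_iff_add_eq_zero]

theorem tensorCoeff_map [Fintype κ] [DecidableEq ι] [DecidableEq κ]
    (b : Module.Basis κ ℂ W) (g : W →ₗ[ℂ] W) (ψ : ⨂[ℂ] _ : ι, W) (z : ι → κ) :
    tensorCoeff b (PiTensorProduct.map (fun _ => g) ψ) z =
      ∑ y, (∏ p, LinearMap.toMatrix b b g (z p) (y p)) * tensorCoeff b ψ y := by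
  induction ψ using PiTensorProduct.induction_on with
  | smul_tprod r f =>
    simp only [map_smul, PiTensorProduct.map_tprod, tensorCoeff_smul, tensorCoeff_tprod,
      mul_left_comm _ r]
    rw [← Finset.mul_sum]
    congr 1
    simp only [← Finset.prod_mul_distrib]
    rw [← Fintype.piFinset_univ,
      ← Finset.prod_univ_sum (fun _ => Finset.univ)
        (fun p w => LinearMap.toMatrix b b g (z p) w * b.repr (f p) w)]
    refine Finset.prod_congr rfl fun p _ => ?_
    rw [← LinearMap.toMatrix_mulVec_repr b b g (f p)]
    rfl
  | add x y hx hy => simp only [map_add, tensorCoeff_add, hx, hy, mul_add,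
      Finset.sum_add_distrib]
end

/-! ### Antisymmetric arrays -/

theorem antisymmetric_eq_zero_of_not_injective {ι κ : Type*} [DecidableEq ι] {f : (ι → κ) → ℂ}
    (hf : ∀ i j, i ≠ j → ∀ z, f (z ∘ Equiv.swap i j) = -f z) {z : ι → κ}
    (hz : ¬ Function.Injective z) : f z = 0 := by
  simp only [Function.Injective, not_forall] at hz
  obtain ⟨i, j, h, hij⟩ := hz
  have hzz : z ∘ Equiv.swap i j = z := by
    funext c
    simp only [Function.comp_apply, Equiv.swap_apply_def]
    grind
  have := hf i j hij z
  rw [hzz] at this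
  exact CharZero.eq_neg_self_iff.1 this

theorem exists_perm_of_injective {ι κ : Type*} [Finite ι] (e : ι ≃ κ) {z : ι → κ}
    (hz : Function.Injective z) : ∃ σ : Equiv.Perm ι, e ∘ σ = z := by
  have h : Function.Injective (e.symm ∘ z) := e.symm.injective.comp hz
  refine ⟨Equiv.ofBijective _ (Finite.injective_iff_bijective.1 h), ?_⟩
  funext c
  simp

section
variable {ι κ : Type*} [Fintype ι] [DecidableEq ι]

theorem antisymmetric_comp_perm {f : (ι → κ) → ℂ}
    (hf : ∀ i j, i ≠ j → ∀ z, f (z ∘ Equiv.swap i j) = -f z) (σ : Equiv.Perm ι) (z : ι → κ) :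
    f (z ∘ σ) = Equiv.Perm.sign σ * f z := by
  induction σ using Equiv.Perm.swap_induction_on' with
  | one => simp
  | mul_swap σ i j hij ih =>
    rw [Equiv.Perm.coe_mul, ← Function.comp_assoc, hf i j hij, ih, Equiv.Perm.sign_mul,
      Equiv.Perm.sign_swap hij]
    simp

/-- When there are as many factors as basis vectors, an antisymmetric array of components is
determined by its value at one bijection. -/
theorem antisymmetric_ext (e : ι ≃ κ) {f g : (ι → κ) → ℂ}
    (hf : ∀ i j, i ≠ j → ∀ z, f (z ∘ Equiv.swap i j) = -f z)
    (hg : ∀ i j, i ≠ j → ∀ z, g (z ∘ Equiv.swap i j) = -g z) (h : f e = g e) : f = g := by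
  funext z
  by_cases hz : Function.Injective z
  · obtain ⟨σ, rfl⟩ := exists_perm_of_injective e hz
    rw [antisymmetric_comp_perm hf, antisymmetric_comp_perm hg, h]
  · rw [antisymmetric_eq_zero_of_not_injective hf hz, antisymmetric_eq_zero_of_not_injective hg hz]

/-- A matrix acts on top-degree antisymmetric tensors by its determinant. -/
theorem sum_prod_mul_antisymmetric [Fintype κ] [DecidableEq κ] (e : ι ≃ κ) {f : (ι → κ) → ℂ}
    (hf : ∀ i j, i ≠ j → ∀ z, f (z ∘ Equiv.swap i j) = -f z) (A : Matrix κ κ ℂ) :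
    ∑ y, (∏ p, A (e p) (y p)) * f y = A.det * f e := by
  rw [← Matrix.det_submatrix_equiv_self e, ← Matrix.det_transpose, Matrix.det_apply',
    Finset.sum_mul]
  symm
  refine Fintype.sum_of_injective (fun σ : Equiv.Perm ι => e ∘ σ)
    (fun σ τ h => Equiv.ext fun c => e.injective (congrFun h c)) _ _ (fun y hy => ?_) fun σ => ?_
  · rw [antisymmetric_eq_zero_of_not_injective hf, mul_zero]
    intro h
    obtain ⟨σ, hσ⟩ := exists_perm_of_injective e h
    exact hy ⟨σ, hσ⟩
  · rw [antisymmetric_comp_perm hf]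
    simp only [Matrix.transpose_apply, Matrix.submatrix_apply, Function.comp_apply]
    ring

theorem exists_antisymmetric [DecidableEq κ] (e : ι ≃ κ) :
    ∃ f : (ι → κ) → ℂ, (∀ i j, i ≠ j → ∀ z, f (z ∘ Equiv.swap i j) = -f z) ∧ f e = 1 := by
  refine ⟨fun z => (Matrix.of fun p q => if z p = e q then 1 else 0 : Matrix ι ι ℂ).det,
    fun i j hij z => ?_, ?_⟩
  · have := Matrix.det_permute (Equiv.swap i j)
      (Matrix.of fun p q => if z p = e q then 1 else 0 : Matrix ι ι ℂ)
    rw [Equiv.Perm.sign_swap hij] at this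
    exact this.trans (by simp)
  · have h : (Matrix.of fun p q => if e p = e q then 1 else 0 : Matrix ι ι ℂ) = 1 := by
      ext p q
      simp [Matrix.one_apply]
    exact (congrArg Matrix.det h).trans Matrix.det_one
end

/-! ### The completely antisymmetric subspace for `n(n+1)/2` quarks -/

set_option synthInstance.maxHeartbeats 200000 in
theorem mem_antisymmetric_iff_add {n k : ℕ} (ψ : WaveFunction n k) :
    ψ ∈ antisymmetricWaveFunctions n k ↔ ∀ i j : Fin k, i ≠ j →
      PiTensorProduct.reindex ℂ (fun _ : Fin k => symTwo n) (Equiv.swap i j) ψ + ψ = 0 :=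
  forall_congr' fun _ => forall_congr' fun _ => forall_congr' fun _ => eq_neg_iff_add_eq_zero

theorem mem_antisymmetric_iff {n k : ℕ} (ψ : WaveFunction n k) :
    ψ ∈ antisymmetricWaveFunctions n k ↔ ∀ i j, i ≠ j → ∀ z,
      tensorCoeff (symTwoBasis n) ψ (z ∘ Equiv.swap i j) = -tensorCoeff (symTwoBasis n) ψ z :=
  (mem_antisymmetric_iff_add ψ).trans <|
    forall_congr' fun i => forall_congr' fun j => forall_congr' fun _ =>
      reindex_add_self_eq_zero_iff (symTwoBasis n) (Equiv.swap i j) ψ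

/-- Definitionally, `quarkRep n U` is `symSquare U`. -/
theorem mem_gaugeSinglets_iff {n k : ℕ} (ψ : WaveFunction n k) :
    ψ ∈ gaugeSinglets n k ↔
      ∀ U : Matrix.specialUnitaryGroup (Fin n) ℂ,
        PiTensorProduct.map (fun _ => symSquare U.1) ψ = ψ := Iff.rfl

theorem map_mem_antisymmetric {n k : ℕ} (g : symTwo n →ₗ[ℂ] symTwo n) {ψ : WaveFunction n k}
    (hψ : ψ ∈ antisymmetricWaveFunctions n k) :
    PiTensorProduct.map (fun _ => g) ψ ∈ antisymmetricWaveFunctions n k :=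
  (mem_antisymmetric_iff_add _).2 fun i j hij =>
    reindex_map_add_map_eq_zero g (Equiv.swap i j) ((mem_antisymmetric_iff_add ψ).1 hψ i j hij)

/-- `U` acts on top-degree antisymmetric tensors by `det (Sym² U) = (det U) ^ (n + 1) = 1`. -/
theorem antisymmetric_le_gaugeSinglets {n k : ℕ} (e : Fin k ≃ Sym2 (Fin n)) :
    antisymmetricWaveFunctions n k ≤ gaugeSinglets n k := by
  intro ψ hψ
  rw [mem_gaugeSinglets_iff]
  intro U
  have hmap := map_mem_antisymmetric (symSquare U.1) hψ
  rw [mem_antisymmetric_iff] at hψ hmap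
  refine tensorCoeff_injective (symTwoBasis n) (antisymmetric_ext e hmap hψ ?_)
  rw [tensorCoeff_map, sum_prod_mul_antisymmetric e hψ]
  change (symSquareMatrix U.1).det * _ = _
  rw [det_symSquareMatrix, (Matrix.mem_specialUnitaryGroup_iff.1 U.2).2, one_pow, one_mul]

theorem finrank_antisymmetric {n k : ℕ} (e : Fin k ≃ Sym2 (Fin n)) :
    Module.finrank ℂ (antisymmetricWaveFunctions n k) = 1 := by
  obtain ⟨f, hf, hfe⟩ := exists_antisymmetric e
  obtain ⟨ψ, rfl⟩ := tensorCoeff_surjective (symTwoBasis n) f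
  have hψ : ψ ∈ antisymmetricWaveFunctions n k := (mem_antisymmetric_iff ψ).2 hf
  refine finrank_eq_one ⟨ψ, hψ⟩ (fun h => ?_) fun φ => ⟨tensorCoeff (symTwoBasis n) φ.1 e, ?_⟩
  · have h0 : ψ = 0 := congrArg Subtype.val h
    rw [h0] at hfe
    exact zero_ne_one ((tensorCoeff_zero (symTwoBasis n) e).symm.trans hfe)
  · apply Subtype.ext
    have hc : tensorCoeff (symTwoBasis n) φ.1 e • ψ ∈ antisymmetricWaveFunctions n k :=
      Submodule.smul_mem _ _ hψ
    refine tensorCoeff_injective (symTwoBasis n) (antisymmetric_ext e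
      ((mem_antisymmetric_iff _).1 hc) ((mem_antisymmetric_iff _).1 φ.2) ?_)
    exact (tensorCoeff_smul (symTwoBasis n) _ ψ e).trans (by rw [hfe, mul_one])

/-! ### The number of quarks in an antisymmetric singlet -/

/-- The components of a wave function, viewed as a tensor over `ℂⁿ` with two sites `(p, false)` and
`(p, true)` for each quark `p`. -/
noncomputable def siteCoeff {n k : ℕ} (ψ : WaveFunction n k) (x : Fin k × Bool → Fin n) : ℂ :=
  tensorCoeff (symTwoBasis n) ψ fun p => s(x (p, false), x (p, true))

set_option synthInstance.maxHeartbeats 200000 in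
theorem exists_siteCoeff_ne_zero {n k : ℕ} {ψ : WaveFunction n k} (hψ : ψ ≠ 0) :
    ∃ x, siteCoeff ψ x ≠ 0 := by
  by_contra! h
  refine hψ (tensorCoeff_injective (symTwoBasis n) (funext fun z => ?_))
  have hz : z = fun p => s((z p).inf, (z p).sup) :=
    funext fun p => (Sym2.sortEquiv.left_inv (z p)).symm
  refine Eq.trans ?_ (tensorCoeff_zero (symTwoBasis n) z).symm
  rw [hz]
  exact h fun a => if a.2 then (z a.1).sup else (z a.1).inf

theorem siteCoeff_map {n k : ℕ} (M : Matrix (Fin n) (Fin n) ℂ) (ψ : WaveFunction n k)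
    (x : Fin k × Bool → Fin n) :
    siteCoeff (PiTensorProduct.map (fun _ => symSquare M) ψ) x =
      ∑ y, (∏ a, M (x a) (y a)) * siteCoeff ψ y := by
  unfold siteCoeff
  induction ψ using PiTensorProduct.induction_on with
  | smul_tprod r f =>
    rw [LinearMap.map_smul]
    simp only [PiTensorProduct.map_tprod, tensorCoeff_smul, tensorCoeff_tprod, mul_left_comm _ r]
    rw [← Finset.mul_sum]
    congr 1
    simp only [symTwoBasis_repr_symSquare, Fintype.prod_prod_type, Fintype.prod_bool,
      ← Finset.prod_mul_distrib]
    rw [Finset.prod_univ_sum, Fintype.piFinset_univ]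
    refine Fintype.sum_equiv
      { toFun := fun y a => if a.2 then (y a.1).2 else (y a.1).1
        invFun := fun x p => (x (p, false), x (p, true))
        left_inv := fun y => rfl
        right_inv := fun x => by
          funext ⟨p, c⟩
          cases c <;> rfl } _ _ fun y => ?_
    refine Finset.prod_congr rfl fun p _ => ?_
    simp [mul_comm]
  | add φ ψ hφ hψ =>
    rw [LinearMap.map_add]
    simp only [tensorCoeff_add, mul_add, Finset.sum_add_distrib]
    rw [hφ, hψ]

theorem siteCoeff_comp_swap_pair {n k : ℕ} (ψ : WaveFunction n k) (p : Fin k)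
    (x : Fin k × Bool → Fin n) :
    siteCoeff ψ (x ∘ Equiv.swap (p, false) (p, true)) = siteCoeff ψ x := by
  unfold siteCoeff
  congr 1
  funext q
  by_cases h : q = p
  · subst h
    simp [Sym2.eq_swap]
  · simp [Equiv.swap_apply_of_ne_of_ne, h]

/-- Transposing one index of quark `q` with one of quark `p`, and then also the two remaining
indices, exchanges the quarks up to the order of the indices within each; so the two transpositions
have opposite effects. -/
theorem siteCoeff_add_comp_swap {n k : ℕ} {ψ : WaveFunction n k}
    (hψ : ψ ∈ antisymmetricWaveFunctions n k) {p q : Fin k} (hqp : q ≠ p) (c d : Bool)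
    (x : Fin k × Bool → Fin n) :
    siteCoeff ψ (x ∘ Equiv.swap (q, c) (p, d)) + siteCoeff ψ (x ∘ Equiv.swap (q, !c) (p, !d)) =
      0 := by
  rw [add_eq_zero_iff_eq_neg, siteCoeff, siteCoeff,
    ← (mem_antisymmetric_iff ψ).1 hψ q p hqp]
  congr 1
  funext r
  rcases eq_or_ne r q with rfl | hq
  · cases c <;> cases d <;> simp [Equiv.swap_apply_def, hqp, hqp.symm, Sym2.eq_swap]
  · rcases eq_or_ne r p with rfl | hp
    · cases c <;> cases d <;> simp [Equiv.swap_apply_def, hqp, hqp.symm, Sym2.eq_swap]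
    · simp [Equiv.swap_apply_def, hp, hq]

/-- Among the transpositions that move an index of quark `p`, those with other quarks cancel in
pairs, and only the exchange of the two indices of `p` itself is left, once for each index. -/
theorem sum_siteCoeff_comp_swap {n k : ℕ} {ψ : WaveFunction n k}
    (hψ : ψ ∈ antisymmetricWaveFunctions n k) (p : Fin k) (x : Fin k × Bool → Fin n) :
    ∑ c, ∑ a ∈ Finset.univ.erase (p, c), siteCoeff ψ (x ∘ Equiv.swap a (p, c)) =
      2 * siteCoeff ψ x := by
  let F : Fin k → Bool → Bool → ℂ := fun q c d => siteCoeff ψ (x ∘ Equiv.swap (q, c) (p, d))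
  have hother : ∀ q, q ≠ p → ∑ c, ∑ d, F q c d = 0 := fun q hq => by
    have h1 := siteCoeff_add_comp_swap hψ hq false false x
    have h2 := siteCoeff_add_comp_swap hψ hq false true x
    simp only [Fintype.sum_bool, F]
    simp only [Bool.not_false, Bool.not_true] at h1 h2
    linear_combination h1 + h2
  have hself : ∀ c d, F p c d = siteCoeff ψ x := fun c d => by
    have h := siteCoeff_comp_swap_pair ψ p x
    cases c <;> cases d <;> simp only [F, Equiv.swap_self, Equiv.coe_refl, Function.comp_id]
    · exact h
    · rw [Equiv.swap_comm, h]
  have hsum : ∑ d, ∑ a : Fin k × Bool, siteCoeff ψ (x ∘ Equiv.swap a (p, d)) =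
      4 * siteCoeff ψ x := by
    simp only [Fintype.sum_prod_type]
    rw [Finset.sum_comm, Finset.sum_eq_single p]
    · rw [Finset.sum_comm]
      refine (Finset.sum_congr rfl fun c _ => Finset.sum_congr rfl fun d _ => hself c d).trans ?_
      simp only [Fintype.sum_bool]
      ring
    · intro q _ hq
      rw [Finset.sum_comm]
      exact hother q hq
    · simp
  have hdiag : ∀ d, ∑ a ∈ Finset.univ.erase (p, d), siteCoeff ψ (x ∘ Equiv.swap a (p, d)) =
      ∑ a : Fin k × Bool, siteCoeff ψ (x ∘ Equiv.swap a (p, d)) - siteCoeff ψ x := fun d => by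
    rw [Finset.sum_erase_eq_sub (Finset.mem_univ _)]
    congr 1
    exact hself d d
  simp only [hdiag, Finset.sum_sub_distrib, hsum]
  simp only [Fintype.sum_bool]
  ring

set_option synthInstance.maxHeartbeats 200000 in
/-- Comparing the two evaluations of the transpositions at the two sites of one quark gives
`n + 1 = 2k / n`. -/
theorem card_of_antisymmetric_singlet {n k : ℕ} (hk : 1 ≤ k) {ψ : WaveFunction n k}
    (hψ : ψ ∈ antisymmetricWaveFunctions n k) (hs : ψ ∈ gaugeSinglets n k) (h0 : ψ ≠ 0) :
    k = n * (n + 1) / 2 := by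
  obtain ⟨x, hx⟩ := exists_siteCoeff_ne_zero h0
  have hT : ∀ U : Matrix.specialUnitaryGroup (Fin n) ℂ, ∀ x,
      ∑ y, (∏ a, U.1 (x a) (y a)) * siteCoeff ψ y = siteCoeff ψ x := fun U x => by
    rw [← siteCoeff_map, (mem_gaugeSinglets_iff ψ).1 hs U]
  let p : Fin k := ⟨0, hk⟩
  have hsum := sum_siteCoeff_comp_swap hψ p x
  have h1 := sum_swap_of_invariant hT (p, false) x
  have h2 := sum_swap_of_invariant hT (p, true) x
  rw [Fintype.sum_bool] at hsum
  rw [Fintype.card_prod, Fintype.card_fin, Fintype.card_bool, Nat.cast_mul] at h1 h2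
  have h3 : ((n * (n + 1) : ℕ) : ℂ) = (2 * k : ℕ) := by
    refine mul_right_cancel₀ hx ?_
    push_cast at h1 h2 ⊢
    linear_combination (h1 + h2 - n * hsum) / 2
  have h4 := Nat.cast_injective h3
  omega

theorem proposition1 (n : ℕ) (hn : 1 ≤ n) :
    Module.finrank ℂ (symTwo n) = n * (n + 1) / 2 ∧
    (∀ k : ℕ, 1 ≤ k →
      ((∃ ψ ∈ antisymmetricWaveFunctions n k ⊓ gaugeSinglets n k, ψ ≠ 0) ↔
        k = n * (n + 1) / 2)) ∧
    Module.finrank ℂ ↥(antisymmetricWaveFunctions n (n * (n + 1) / 2) ⊓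
      gaugeSinglets n (n * (n + 1) / 2)) = 1 ∧
    antisymmetricWaveFunctions n (n * (n + 1) / 2) ⊓ gaugeSinglets n (n * (n + 1) / 2) =
      antisymmetricWaveFunctions n (n * (n + 1) / 2) := by
  have e : Fin (n * (n + 1) / 2) ≃ Sym2 (Fin n) :=
    (Fintype.equivFinOfCardEq (card_sym2_fin n)).symm
  have hinf := inf_eq_left.2 (antisymmetric_le_gaugeSinglets e)
  have hrank := finrank_antisymmetric e
  refine ⟨finrank_symTwo n, fun k hk => ⟨?_, ?_⟩, by rw [hinf, hrank], hinf⟩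
  · rintro ⟨ψ, hψ, h0⟩
    exact card_of_antisymmetric_singlet hk hψ.1 hψ.2 h0
  · rintro rfl
    obtain ⟨ψ, h0, -⟩ := finrank_eq_one_iff'.1 hrank
    exact ⟨ψ.1, hinf.ge ψ.2, fun h => h0 (Subtype.ext h)⟩
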